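/- Let $\Omega\in(0,\pi)$, and let $\ell_2=\ell_2(\mathbb{Z},\mathbb{R})$ be the Hilbert space of real square-summable two-sided sequences. Let $\mathcal{Y}\subset\ell_2$ be the linear subspace of band-limited sequences, that is, of all $x\in\ell_2$ of the form $$x(t)=\frac{1}{2\pi}\int_{-\pi}^{\pi}X(e^{i\omega})e^{i\omega t}\,d\omega,\qquad t\in\mathbb{Z},$$ for some $X:\{z\in\mathbb{C}:|z|=1\}\to\mathbb{C}$ such that $\omega\mapsto X(e^{i\omega})$ belongs to $L_2(-\pi,\pi)$ and $X(e^{i\omega})=0$ for $\Omega<|\omega|\le\pi$. Let $D\subset\mathbb{Z}$ be such that, for some $s\in\mathbb{Z}$, either $\{t\in\mathbb{Z}: t\le s\}\subset D$ or $\{t\in\mathbb{Z}: t\ge s\}\subset D$. Let $\mathcal{Y}(D)\subset\ell_2(D,\mathbb{R})$ be the set of the traces $\{y(t)\}_{t\in D}$ of all $y\in\mathcal{Y}$. Then: (i) for every $x\in\mathcal{Y}(D)$ there exists a unique $\widehat{x}\in\mathcal{Y}$ such that $\widehat{x}(t)=x(t)$ for all $t\in D$; (ii) $\mathcal{Y}$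 is a closed linear subspace of $\ell_2(\mathbb{Z},\mathbb{R})$. -/

import Mathlib

open MeasureTheory

noncomputable section

namespace DataRecovery

/-- The space `ℓ₂(G, V)` of square-summable families in `V` indexed by `G`. -/
abbrev Ell2 (G V : Type*) [NormedAddCommGroup V] : Type _ := lp (fun _ : G => V) 2

section Traces

variable {G V : Type*} [NormedAddCommGroup V] [InnerProductSpace ℝ V]

/-- The trace `{x(t)}_{t ∈ D}` of a sequence `x ∈ ℓ₂(G, V)`, as an element of `ℓ₂(D, V)`. -/
def trace (D : Set G) (x : Ell2 G V) : Ell2 D V :=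
  ⟨fun t => x t, by
    have h := lp.memℓp x
    rw [memℓp_gen_iff (by norm_num)] at h
    exact memℓp_gen (h.comp_injective Subtype.val_injective)⟩

/-- The set `𝒴(D)` of the traces on `D` of all sequences in `𝒴`. -/
def traces (Y : Submodule ℝ (Ell2 G V)) (D : Set G) : Set (Ell2 D V) :=
  trace D '' (Y : Set (Ell2 G V))

/-- The recoverability condition on a linear subspace `𝒴 ⊆ ℓ₂(G, V)` and a set `D ⊆ G`. -/
structure RecoveryCondition (Y : Submodule ℝ (Ell2 G V)) (D : Set G) : Prop where
  existsUnique : ∀ x ∈ traces Y D, ∃! y : Ell2 G V, y ∈ Y ∧ ∀ t : D, y t = x t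
  isClosed : IsClosed (Y : Set (Ell2 G V))

end Traces

/-- The inverse Z-transform
`(𝒵⁻¹ X)(t) = (1 / 2π) ∫_{-π}^{π} X(e^{iω}) e^{iωt} dω` of `X : 𝕋 → ℂ`. -/
def invZ (X : Circle → ℂ) (t : ℤ) : ℂ :=
  (1 / (2 * (Real.pi : ℂ))) *
    ∫ ω in (-Real.pi)..Real.pi,
      X (Circle.exp ω) * Complex.exp (Complex.I * (ω : ℂ) * (t : ℂ))

/-- `X : 𝕋 → ℂ` has `X(e^{iω}) ∈ L₂(-π, π)` and `X(e^{iω}) = 0` for `Ω < |ω| ≤ π`. -/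
structure IsBandLimitedSpectrum (Ω : ℝ) (X : Circle → ℂ) : Prop where
  memLp : MemLp (fun ω : ℝ => X (Circle.exp ω)) 2
    (volume.restrict (Set.Ioc (-Real.pi) Real.pi))
  eq_zero : ∀ ω : ℝ, |ω| ≤ Real.pi → Ω < |ω| → X (Circle.exp ω) = 0

theorem IsBandLimitedSpectrum.intervalIntegrable {Ω : ℝ} {X : Circle → ℂ}
    (h : IsBandLimitedSpectrum Ω X) (t : ℤ) :
    IntervalIntegrable
      (fun ω : ℝ => X (Circle.exp ω) * Complex.exp (Complex.I * (ω : ℂ) * (t : ℂ)))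
      volume (-Real.pi) Real.pi := by
  have h1 : IntervalIntegrable (fun ω : ℝ => X (Circle.exp ω)) volume (-Real.pi) Real.pi := by
    rw [intervalIntegrable_iff_integrableOn_Ioc_of_le (by linarith [Real.pi_pos])]
    exact h.memLp.integrable (by norm_num)
  exact h1.mul_continuousOn (by fun_prop)

/-- The linear space of band-limited real sequences in `ℓ₂ = ℓ₂(ℤ, ℝ)`: those of the form
`x = 𝒵⁻¹ X` with `X(e^{iω})` square-integrable and vanishing for `|ω| > Ω`. -/
def bandLimited (Ω : ℝ) : Submodule ℝ (Ell2 ℤ ℝ) where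
  carrier := {x | ∃ X : Circle → ℂ, IsBandLimitedSpectrum Ω X ∧
    ∀ t : ℤ, ((x t : ℝ) : ℂ) = invZ X t}
  zero_mem' := ⟨0, ⟨MemLp.zero', fun _ _ _ => rfl⟩, fun t => by simp [invZ]⟩
  add_mem' := by
    rintro x y ⟨X, hX, hx⟩ ⟨Y, hY, hy⟩
    refine ⟨X + Y, ⟨hX.memLp.add hY.memLp, fun ω h h' => ?_⟩, fun t => ?_⟩
    · simp [hX.eq_zero ω h h', hY.eq_zero ω h h']
    · have := intervalIntegral.integral_add (hX.intervalIntegrable t) (hY.intervalIntegrable t)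
      simp only [lp.coeFn_add, Pi.add_apply, Complex.ofReal_add, hx, hy, invZ, add_mul, this,
        mul_add]
  smul_mem' := by
    rintro c x ⟨X, hX, hx⟩
    refine ⟨fun z => (c : ℂ) * X z, ⟨hX.memLp.const_mul _, fun ω h h' => ?_⟩, fun t => ?_⟩
    · simp [hX.eq_zero ω h h']
    · simp only [lp.coeFn_smul, Pi.smul_apply, smul_eq_mul, Complex.ofReal_mul, hx, invZ,
        mul_assoc, intervalIntegral.integral_const_mul]
      ring

end DataRecovery

end

noncomputable section

namespace DataRecovery

/-! ### Unique continuation from a half-line. -/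

section OneSided

open Polynomial

/-! By linearity, uniqueness says that a band-limited sequence vanishing on a half-line is zero. Let
`F` live on `|ω| ≤ Ω` and let its moments up to `a` vanish. With `r = 2 / (1 - cos Ω)`, the symbol
`r (1 - cos ω) - 1` maps the band into `[-1, 1]`, so its Chebyshev polynomials `Tₙ` are bounded by 1
there. Their extreme Fourier coefficients are nevertheless `(-r)ⁿ / 2` for `n ≥ 1`, and `r > 1`.
Testing `F` against `Tₙ₊₁` at index `a - n` picks out `(-r)ⁿ⁺¹ / 2` times the moment at `a + 1`,
while the result stays below `∫ ‖F‖`; hence that moment is zero (`trigMoment_succ_eq_zero`), and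
induction reaches every index.

For closedness, Parseval turns band-limitation into the vanishing of an `L²` function on the stop
band, a closed condition (`mem_bandLimited_iff`). -/

/-- The trigonometric moment `∫_{-π}^{π} F(ω) e^{iωt} dω`. -/
def trigMoment (F : ℝ → ℂ) (t : ℤ) : ℂ :=
  ∫ ω in (-Real.pi)..Real.pi, F ω * Complex.exp (Complex.I * (ω : ℂ) * (t : ℂ))

/-- The real trigonometric polynomial `r (1 - cos ω) - 1`. -/
def cosSymbol (r ω : ℝ) : ℝ := r * (1 - Real.cos ω) - 1

/-- The product of `F` with the Chebyshev polynomial `Tₙ` evaluated at `cosSymbol r`. -/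
def chebyshevMul (r : ℝ) (F : ℝ → ℂ) (n : ℕ) (ω : ℝ) : ℂ :=
  F ω * (((Chebyshev.T ℝ n).eval (cosSymbol r ω) : ℝ) : ℂ)

theorem continuous_cosSymbol (r : ℝ) : Continuous (cosSymbol r) := by
  unfold cosSymbol
  fun_prop

theorem intervalIntegrable_chebyshevMul {r a b : ℝ} {F : ℝ → ℂ}
    (hF : IntervalIntegrable F volume a b) (n : ℕ) :
    IntervalIntegrable (chebyshevMul r F n) volume a b := by
  refine hF.mul_continuousOn (Continuous.continuousOn ?_)
  exact Complex.continuous_ofReal.comp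
    ((Polynomial.continuous _).comp (continuous_cosSymbol r))

theorem intervalIntegrable_mul_exp {a b : ℝ} {F : ℝ → ℂ}
    (hF : IntervalIntegrable F volume a b) (t : ℤ) :
    IntervalIntegrable (fun ω : ℝ => F ω * Complex.exp (Complex.I * (ω : ℂ) * (t : ℂ)))
      volume a b :=
  hF.mul_continuousOn (by fun_prop)

theorem two_mul_cosSymbol_mul_exp (r ω : ℝ) (t : ℤ) :
    2 * (cosSymbol r ω : ℂ) * Complex.exp (Complex.I * ω * t) =
      2 * (r - 1) * Complex.exp (Complex.I * ω * t) -
        r * (Complex.exp (Complex.I * ω * (t + 1 : ℤ)) +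
          Complex.exp (Complex.I * ω * (t - 1 : ℤ))) := by
  have h1 : Complex.exp (Complex.I * ω * (t + 1 : ℤ)) =
      Complex.exp (Complex.I * ω * t) * Complex.exp (ω * Complex.I) := by
    rw [← Complex.exp_add]; push_cast; ring_nf
  have h2 : Complex.exp (Complex.I * ω * (t - 1 : ℤ)) =
      Complex.exp (Complex.I * ω * t) * Complex.exp (-ω * Complex.I) := by
    rw [← Complex.exp_add]; push_cast; ring_nf
  have h3 : (2 : ℂ) * Complex.cos ω = _ := Complex.two_cos (x := ω)
  rw [h1, h2, cosSymbol]
  push_cast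
  linear_combination (-(r : ℂ) * Complex.exp (Complex.I * ω * t)) * h3

theorem trigMoment_two_mul_cosSymbol {F : ℝ → ℂ} (r : ℝ)
    (hF : IntervalIntegrable F volume (-Real.pi) Real.pi) (t : ℤ) :
    trigMoment (fun ω => F ω * (2 * (cosSymbol r ω : ℂ))) t =
      2 * (r - 1) * trigMoment F t - r * (trigMoment F (t + 1) + trigMoment F (t - 1)) := by
  unfold trigMoment
  rw [← intervalIntegral.integral_add (intervalIntegrable_mul_exp hF _)
    (intervalIntegrable_mul_exp hF _), ← intervalIntegral.integral_const_mul,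
    ← intervalIntegral.integral_const_mul, ← intervalIntegral.integral_sub
      ((intervalIntegrable_mul_exp hF _).const_mul _)
      (((intervalIntegrable_mul_exp hF _).add (intervalIntegrable_mul_exp hF _)).const_mul _)]
  refine intervalIntegral.integral_congr fun ω _ => ?_
  have := two_mul_cosSymbol_mul_exp r ω t
  simp only
  linear_combination F ω * this

theorem trigMoment_chebyshevMul_one {F : ℝ → ℂ} (r : ℝ)
    (hF : IntervalIntegrable F volume (-Real.pi) Real.pi) (t : ℤ) :
    2 * trigMoment (chebyshevMul r F 1) t =
      2 * (r - 1) * trigMoment F t - r * (trigMoment F (t + 1) + trigMoment F (t - 1)) := by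
  rw [← trigMoment_two_mul_cosSymbol r hF]
  unfold trigMoment
  rw [← intervalIntegral.integral_const_mul]
  refine intervalIntegral.integral_congr fun ω _ => ?_
  simp [chebyshevMul]
  ring

theorem trigMoment_chebyshevMul_add_two {F : ℝ → ℂ} (r : ℝ)
    (hF : IntervalIntegrable F volume (-Real.pi) Real.pi) (n : ℕ) (t : ℤ) :
    trigMoment (chebyshevMul r F (n + 2)) t =
      2 * (r - 1) * trigMoment (chebyshevMul r F (n + 1)) t -
        r * (trigMoment (chebyshevMul r F (n + 1)) (t + 1) +
          trigMoment (chebyshevMul r F (n + 1)) (t - 1)) - trigMoment (chebyshevMul r F n) t := by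
  have hi := intervalIntegrable_chebyshevMul (r := r) hF (n + 1)
  rw [← trigMoment_two_mul_cosSymbol r hi]
  unfold trigMoment
  rw [← intervalIntegral.integral_sub]
  · refine intervalIntegral.integral_congr fun ω _ => ?_
    simp [chebyshevMul, Chebyshev.T_add_two]
    ring
  · refine intervalIntegrable_mul_exp (hi.mul_continuousOn ?_) t
    have := continuous_cosSymbol r
    fun_prop
  · exact intervalIntegrable_mul_exp (intervalIntegrable_chebyshevMul hF n) t

/-- Multiplication by `Tₙ` of the symbol mixes moments at distance at most `n`, so each degree costs
one index of vanishing. At the first index not covered, only the extreme coefficient contributes.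
Two consecutive degrees are carried because the Chebyshev recurrence has order two. -/
theorem trigMoment_chebyshevMul_of_vanish {F : ℝ → ℂ} (r : ℝ)
    (hF : IntervalIntegrable F volume (-Real.pi) Real.pi) {a : ℤ}
    (h0 : ∀ t ≤ a, trigMoment F t = 0) (n : ℕ) :
    (∀ t ≤ a - n, trigMoment (chebyshevMul r F n) t = 0) ∧
    (∀ t ≤ a - (n + 1), trigMoment (chebyshevMul r F (n + 1)) t = 0) ∧
      2 * trigMoment (chebyshevMul r F (n + 1)) (a - n) =
        (-r) ^ (n + 1) * trigMoment F (a + 1) := by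
  induction n with
  | zero =>
    have hz : chebyshevMul r F 0 = F := by ext; simp [chebyshevMul]
    refine ⟨by simpa [hz] using h0, fun t ht => ?_, ?_⟩
    · have := trigMoment_chebyshevMul_one r hF t
      rw [h0 t (by simp at ht; omega), h0 (t + 1) (by simp at ht; omega),
        h0 (t - 1) (by simp at ht; omega)] at this
      simpa using this
    · have := trigMoment_chebyshevMul_one r hF a
      rw [h0 a le_rfl, h0 (a - 1) (by omega)] at this
      simp [this]
  | succ n ih =>
    obtain ⟨h1, h2, h3⟩ := ih
    refine ⟨by simpa using h2, fun t ht => ?_, ?_⟩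
    · push_cast at ht
      rw [trigMoment_chebyshevMul_add_two r hF, h1 t (by omega), h2 t (by omega),
        h2 (t + 1) (by omega), h2 (t - 1) (by omega)]
      simp
    · rw [trigMoment_chebyshevMul_add_two r hF]
      push_cast
      rw [h1 _ (by omega), h2 _ (by omega), h2 (_ - 1) (by omega),
        show a - ((n : ℤ) + 1) + 1 = a - n by ring, pow_succ]
      linear_combination (-(r : ℂ)) * h3

theorem norm_trigMoment_le (G : ℝ → ℂ) (t : ℤ) :
    ‖trigMoment G t‖ ≤ ∫ ω in (-Real.pi)..Real.pi, ‖G ω‖ := by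
  refine (intervalIntegral.norm_integral_le_integral_norm (by linarith [Real.pi_pos])).trans_eq ?_
  refine intervalIntegral.integral_congr fun ω _ => ?_
  have : Complex.I * (ω : ℂ) * (t : ℂ) = ((ω * t : ℝ) : ℂ) * Complex.I := by push_cast; ring
  simp only [norm_mul, this, Complex.norm_exp_ofReal_mul_I, mul_one]

theorem abs_cosSymbol_le_one {Ω ω : ℝ} (hΩ_pos : 0 < Ω) (hΩ_lt : Ω < Real.pi) (hω : |ω| ≤ Ω) :
    |cosSymbol (2 / (1 - Real.cos Ω)) ω| ≤ 1 := by
  have h1 : Real.cos Ω ≤ Real.cos ω := by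
    rw [← Real.cos_abs ω]
    exact Real.cos_le_cos_of_nonneg_of_le_pi (abs_nonneg _) hΩ_lt.le hω
  have h2 : Real.cos Ω < 1 := by
    simpa using Real.cos_lt_cos_of_nonneg_of_le_pi le_rfl hΩ_lt.le hΩ_pos
  have h3 := Real.cos_le_one ω
  have h4 : 2 / (1 - Real.cos Ω) * (1 - Real.cos ω) ≤ 2 := by
    rw [div_mul_eq_mul_div, div_le_iff₀ (by linarith)]
    linarith
  have h5 : 0 ≤ 2 / (1 - Real.cos Ω) * (1 - Real.cos ω) :=
    mul_nonneg (div_nonneg zero_le_two (by linarith)) (by linarith)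
  rw [cosSymbol, abs_le]
  constructor <;> linarith

theorem norm_chebyshevMul_le {Ω ω : ℝ} {F : ℝ → ℂ} (hΩ_pos : 0 < Ω) (hΩ_lt : Ω < Real.pi)
    (hF : Ω < |ω| → F ω = 0) (n : ℕ) :
    ‖chebyshevMul (2 / (1 - Real.cos Ω)) F n ω‖ ≤ ‖F ω‖ := by
  rcases le_or_gt |ω| Ω with h | h
  · rw [chebyshevMul, norm_mul, Complex.norm_real, Real.norm_eq_abs]
    exact mul_le_of_le_one_right (norm_nonneg _)
      (Chebyshev.abs_eval_T_real_le_one n (abs_cosSymbol_le_one hΩ_pos hΩ_lt h))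
  · simp [chebyshevMul, hF h]

/-- If `F` vanishes for `Ω < |ω| ≤ π` and its moments of index at most `a` vanish, then so does
the moment of index `a + 1`. -/
theorem trigMoment_succ_eq_zero {Ω : ℝ} (hΩ_pos : 0 < Ω) (hΩ_lt : Ω < Real.pi) {F : ℝ → ℂ}
    (hF : IntervalIntegrable F volume (-Real.pi) Real.pi)
    (hsupp : ∀ ω : ℝ, |ω| ≤ Real.pi → Ω < |ω| → F ω = 0) {a : ℤ}
    (h0 : ∀ t ≤ a, trigMoment F t = 0) : trigMoment F (a + 1) = 0 := by
  -- This `r` sends `cos ω = 1` to `-1` and `cos ω = cos Ω` to `1`.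
  set r : ℝ := 2 / (1 - Real.cos Ω) with hr
  have hcos : Real.cos Ω < 1 := by
    simpa using Real.cos_lt_cos_of_nonneg_of_le_pi le_rfl hΩ_lt.le hΩ_pos
  have hcos' : -1 < Real.cos Ω := by
    simpa using Real.cos_lt_cos_of_nonneg_of_le_pi hΩ_pos.le le_rfl hΩ_lt
  -- The gap `Ω < π` enters here: for `Ω = π` one would get `r = 1` and no growth.
  have hr1 : 1 < r := by rw [hr, one_lt_div (by linarith)]; linarith
  set C := ∫ ω in (-Real.pi)..Real.pi, ‖F ω‖
  have key : ∀ n : ℕ, r ^ (n + 1) * ‖trigMoment F (a + 1)‖ ≤ 2 * C := by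
    intro n
    have h1 := congrArg norm (trigMoment_chebyshevMul_of_vanish r hF h0 n).2.2
    rw [norm_mul, norm_mul, norm_pow, norm_neg, Complex.norm_real, Real.norm_eq_abs,
      abs_of_pos (by linarith), Complex.norm_ofNat] at h1
    rw [← h1]
    refine mul_le_mul_of_nonneg_left ((norm_trigMoment_le _ _).trans ?_) zero_le_two
    refine intervalIntegral.integral_mono_on (by linarith [Real.pi_pos])
      (intervalIntegrable_chebyshevMul hF _).norm hF.norm fun ω hω => ?_
    exact norm_chebyshevMul_le hΩ_pos hΩ_lt (hsupp ω (abs_le.2 hω)) _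
  by_contra hne
  have hpos : 0 < ‖trigMoment F (a + 1)‖ := norm_pos_iff.2 hne
  obtain ⟨n, hn⟩ := pow_unbounded_of_one_lt (2 * C / ‖trigMoment F (a + 1)‖) hr1
  have h2 := key n
  rw [← le_div_iff₀ hpos] at h2
  have h3 : r ^ n ≤ r ^ (n + 1) := pow_le_pow_right₀ hr1.le (Nat.le_succ n)
  linarith

theorem trigMoment_eq_zero_of_le {Ω : ℝ} (hΩ_pos : 0 < Ω) (hΩ_lt : Ω < Real.pi) {F : ℝ → ℂ}
    (hF : IntervalIntegrable F volume (-Real.pi) Real.pi)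
    (hsupp : ∀ ω : ℝ, |ω| ≤ Real.pi → Ω < |ω| → F ω = 0) {s : ℤ}
    (h0 : ∀ t ≤ s, trigMoment F t = 0) (t : ℤ) : trigMoment F t = 0 := by
  have h : ∀ n : ℕ, ∀ t ≤ s + n, trigMoment F t = 0 := by
    intro n
    induction n with
    | zero => simpa using h0
    | succ n ih =>
      intro t ht
      rcases eq_or_ne t (s + n + 1) with rfl | hne
      · exact trigMoment_succ_eq_zero hΩ_pos hΩ_lt hF hsupp ih
      · exact ih t (by push_cast at ht; omega)
  exact h (t - s).toNat t (by omega)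

theorem trigMoment_comp_neg (F : ℝ → ℂ) (t : ℤ) :
    trigMoment (fun ω => F (-ω)) t = trigMoment F (-t) := by
  have := intervalIntegral.integral_comp_neg (a := -Real.pi) (b := Real.pi)
    (fun ω : ℝ => F ω * Complex.exp (Complex.I * (ω : ℂ) * ((-t : ℤ) : ℂ)))
  rw [neg_neg] at this
  simp only [trigMoment, ← this]
  refine intervalIntegral.integral_congr fun ω _ => ?_
  push_cast
  ring_nf

/-- The reflection `ω ↦ -ω` preserves the band and exchanges the two kinds of half-line. -/
theorem trigMoment_eq_zero_of_ge {Ω : ℝ} (hΩ_pos : 0 < Ω) (hΩ_lt : Ω < Real.pi) {F : ℝ → ℂ}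
    (hF : IntervalIntegrable F volume (-Real.pi) Real.pi)
    (hsupp : ∀ ω : ℝ, |ω| ≤ Real.pi → Ω < |ω| → F ω = 0) {s : ℤ}
    (h0 : ∀ t, s ≤ t → trigMoment F t = 0) (t : ℤ) : trigMoment F t = 0 := by
  have hF' : IntervalIntegrable (fun ω => F (-ω)) volume (-Real.pi) Real.pi := by
    simpa using ((IntervalIntegrable.iff_comp_neg (by finiteness)).1 hF).symm
  have := trigMoment_eq_zero_of_le hΩ_pos hΩ_lt hF'
    (fun ω h h' => hsupp (-ω) (by simpa using h) (by simpa using h')) (s := -s)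
    (fun t ht => by rw [trigMoment_comp_neg]; exact h0 _ (by omega)) (-t)
  rwa [trigMoment_comp_neg, neg_neg] at this

theorem IsBandLimitedSpectrum.intervalIntegrable_comp_exp {Ω : ℝ} {X : Circle → ℂ}
    (h : IsBandLimitedSpectrum Ω X) :
    IntervalIntegrable (fun ω : ℝ => X (Circle.exp ω)) volume (-Real.pi) Real.pi := by
  simpa using h.intervalIntegrable 0

/-- A band-limited sequence that vanishes on a half-line of `ℤ` is zero. -/
theorem eq_zero_of_mem_bandLimited {Ω : ℝ} (hΩ_pos : 0 < Ω) (hΩ_lt : Ω < Real.pi)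
    {x : Ell2 ℤ ℝ} (hx : x ∈ bandLimited Ω) {s : ℤ}
    (h : (∀ t ≤ s, x t = 0) ∨ ∀ t, s ≤ t → x t = 0) : x = 0 := by
  obtain ⟨X, hX, hxX⟩ := hx
  have hiff : ∀ t, x t = 0 ↔ trigMoment (fun ω => X (Circle.exp ω)) t = 0 := fun t => by
    rw [← Complex.ofReal_eq_zero, hxX, invZ]
    simp [trigMoment, Real.pi_ne_zero]
  simp only [hiff] at h
  have hi := hX.intervalIntegrable_comp_exp
  ext t
  rw [hiff t |>.2 ?_]; · rfl
  rcases h with h | h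
  · exact trigMoment_eq_zero_of_le hΩ_pos hΩ_lt hi hX.eq_zero h t
  · exact trigMoment_eq_zero_of_ge hΩ_pos hΩ_lt hi hX.eq_zero h t

end OneSided

/-! ### Closedness via Fourier series on the circle. -/

section Closed

open AddCircle ComplexConjugate

instance fact_two_pi_pos : Fact (0 < 2 * Real.pi) := ⟨Real.two_pi_pos⟩

theorem memℓp_ofReal (x : Ell2 ℤ ℝ) : Memℓp (fun t => ((x t : ℝ) : ℂ)) 2 := by
  have h := lp.memℓp x
  rw [memℓp_gen_iff (by norm_num)] at h
  exact memℓp_gen (by simpa using h)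

/-- The complexification `ℓ₂(ℤ, ℝ) → ℓ₂(ℤ, ℂ)`. -/
def complexify : Ell2 ℤ ℝ →+ Ell2 ℤ ℂ where
  toFun x := ⟨fun t => ((x t : ℝ) : ℂ), memℓp_ofReal x⟩
  map_zero' := by ext; simp
  map_add' x y := by ext; simp; rfl

@[simp]
theorem complexify_apply (x : Ell2 ℤ ℝ) (t : ℤ) : complexify x t = ((x t : ℝ) : ℂ) := rfl

theorem continuous_complexify : Continuous complexify := by
  refine (AddMonoidHomClass.isometry_of_norm complexify fun x => ?_).continuous
  rw [lp.norm_eq_tsum_rpow (by norm_num), lp.norm_eq_tsum_rpow (by norm_num)]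
  simp

/-- The function `θ ↦ conj X(e^{iθ})` on `ℝ / 2πℤ`. -/
def conjSpectrum (X : Circle → ℂ) (θ : AddCircle (2 * Real.pi)) : ℂ :=
  conj (X (homeomorphCircle' θ))

@[simp]
theorem conjSpectrum_coe (X : Circle → ℂ) (ω : ℝ) :
    conjSpectrum X (ω : AddCircle (2 * Real.pi)) = conj (X (Circle.exp ω)) := rfl

/-- `fourierCoeff` integrates against `e^{-iωt}` and `invZ` against `e^{iωt}`; conjugation
reconciles the signs. -/
theorem conj_invZ (X : Circle → ℂ) (t : ℤ) :
    conj (invZ X t) = fourierCoeff (conjSpectrum X) t := by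
  rw [fourierCoeff_eq_intervalIntegral _ _ (-Real.pi),
    show -Real.pi + 2 * Real.pi = Real.pi by ring, invZ, map_mul,
    intervalIntegral.integral_of_le (by linarith [Real.pi_pos]),
    intervalIntegral.integral_of_le (by linarith [Real.pi_pos]), ← integral_conj,
    Complex.real_smul]
  congr 1
  · simp [Complex.conj_ofNat]
  · refine integral_congr_ae (Filter.Eventually.of_forall fun ω => ?_)
    simp only [map_mul, conjSpectrum_coe, smul_eq_mul, fourier_coe_apply, ← Complex.exp_conj,
      Complex.conj_I, Complex.conj_ofReal, map_intCast]
    rw [mul_comm]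
    congr 2
    have : (Real.pi : ℂ) ≠ 0 := by exact_mod_cast Real.pi_ne_zero
    push_cast
    field_simp

theorem memLp_conjSpectrum_iff (X : Circle → ℂ) :
    MemLp (conjSpectrum X) 2 haarAddCircle ↔
      MemLp (fun ω : ℝ => X (Circle.exp ω)) 2
        (volume.restrict (Set.Ioc (-Real.pi) Real.pi)) := by
  have hend : -Real.pi + 2 * Real.pi = Real.pi := by ring
  rw [memLp_haarAddCircle_iff]
  constructor
  · intro h
    have h1 := h.comp_measurePreserving (AddCircle.measurePreserving_mk (2 * Real.pi) (-Real.pi))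
    rw [hend] at h1
    convert h1.star using 1
    ext ω
    simp
  · intro h
    have h1 : MemLp (fun ω : ℝ => conj (X (Circle.exp ω))) 2
        (volume.restrict (Set.Ioc (-Real.pi) (-Real.pi + 2 * Real.pi))) := by
      rw [hend]; exact h.star
    convert h1.memLp_liftIoc using 1
    ext θ
    obtain ⟨ω, hω, rfl⟩ := AddCircle.coe_image_Ioc_eq (2 * Real.pi) (-Real.pi) ▸ Set.mem_univ θ
    rw [liftIoc_coe_apply hω, conjSpectrum_coe]

theorem norm_coe_of_abs_le_pi {ω : ℝ} (h : |ω| ≤ Real.pi) :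
    ‖(ω : AddCircle (2 * Real.pi))‖ = |ω| := by
  rw [norm_coe_eq_abs_iff _ Real.two_pi_pos.ne', abs_of_pos Real.two_pi_pos]
  linarith

/-- The stop band `{θ : Ω < |θ|}` in `ℝ / 2πℤ`. -/
def stopBand (Ω : ℝ) : Set (AddCircle (2 * Real.pi)) := {θ | Ω < ‖θ‖}

theorem measurableSet_stopBand (Ω : ℝ) : MeasurableSet (stopBand Ω) :=
  measurableSet_lt measurable_const measurable_norm

theorem vanish_iff_conjSpectrum (Ω : ℝ) (X : Circle → ℂ) :
    (∀ ω : ℝ, |ω| ≤ Real.pi → Ω < |ω| → X (Circle.exp ω) = 0) ↔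
      ∀ θ ∈ stopBand Ω, conjSpectrum X θ = 0 := by
  constructor
  · intro h θ hθ
    obtain ⟨ω, hω, rfl⟩ := AddCircle.coe_image_Ioc_eq (2 * Real.pi) (-Real.pi) ▸ Set.mem_univ θ
    have hω' : |ω| ≤ Real.pi := abs_le.2 ⟨hω.1.le, by linarith [hω.2]⟩
    rw [stopBand, Set.mem_ofPred_eq, norm_coe_of_abs_le_pi hω'] at hθ
    simp [h ω hω' hθ]
  · intro h ω hω hω'
    simpa using h ω (by rwa [stopBand, Set.mem_ofPred_eq, norm_coe_of_abs_le_pi hω])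

/-- Exhibits the space as the zero set of a continuous map: complexify, take the Fourier series,
restrict to the stop band. -/
theorem mem_bandLimited_iff (Ω : ℝ) (x : Ell2 ℤ ℝ) :
    x ∈ bandLimited Ω ↔
      LpToLpRestrictCLM _ ℂ ℂ haarAddCircle 2 (stopBand Ω)
        ((fourierBasis (T := 2 * Real.pi)).repr.symm (complexify x)) = 0 := by
  rw [Lp.eq_zero_iff_ae_eq_zero]
  constructor
  · rintro ⟨X, hX, hx⟩
    have hm := (memLp_conjSpectrum_iff X).2 hX.memLp
    have hrepr : (fourierBasis (T := 2 * Real.pi)).repr.symm (complexify x) = hm.toLp := by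
      rw [LinearIsometryEquiv.symm_apply_eq]
      ext t
      rw [fourierBasis_repr, fourierCoeff_congr_ae hm.coeFn_toLp, ← conj_invZ, ← hx]
      simp
    rw [hrepr]
    filter_upwards [LpToLpRestrictCLM_coeFn ℂ (stopBand Ω) hm.toLp,
      ae_restrict_of_ae hm.coeFn_toLp, ae_restrict_mem (measurableSet_stopBand Ω)] with θ h1 h2 h3
    rw [h1, h2]
    exact (vanish_iff_conjSpectrum Ω X).1 hX.eq_zero θ h3
  · intro h
    set f := (fourierBasis (T := 2 * Real.pi)).repr.symm (complexify x) with hf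
    have hf0 : ∀ᵐ θ ∂haarAddCircle, θ ∈ stopBand Ω → f θ = 0 := by
      rw [← ae_restrict_iff' (measurableSet_stopBand Ω)]
      filter_upwards [h, LpToLpRestrictCLM_coeFn ℂ (stopBand Ω) f] with θ h1 h2
      rw [← h2, h1]; rfl
    -- `f` vanishes only almost everywhere on the stop band, but a spectrum must vanish there at
    -- every point; `g` is the corrected representative.
    set g : AddCircle (2 * Real.pi) → ℂ := (stopBand Ω)ᶜ.indicator f with hg
    have hfg : f =ᵐ[haarAddCircle] g := by
      filter_upwards [hf0] with θ hθ
      by_cases hmem : θ ∈ stopBand Ω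
      · simp [hg, hmem, hθ hmem]
      · simp [hg, hmem]
    let X : Circle → ℂ := fun z => conj (g (homeomorphCircle'.symm z))
    have hX : conjSpectrum X = g := by
      ext θ
      simp only [conjSpectrum, X, Homeomorph.symm_apply_apply, Complex.conj_conj]
    refine ⟨X, ⟨?_, ?_⟩, fun t => ?_⟩
    · rw [← memLp_conjSpectrum_iff, hX]
      exact (memLp_congr_ae hfg).1 (Lp.memLp f)
    · rw [vanish_iff_conjSpectrum, hX]
      intro θ hθ
      simp [hg, hθ]
    · have h1 : (fourierBasis (T := 2 * Real.pi)).repr f t = complexify x t := by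
        rw [hf, LinearIsometryEquiv.apply_symm_apply]
      rw [fourierBasis_repr, fourierCoeff_congr_ae hfg, ← hX, ← conj_invZ, complexify_apply] at h1
      rw [← Complex.conj_conj (invZ X t), h1, Complex.conj_ofReal]

theorem isClosed_bandLimited (Ω : ℝ) : IsClosed (bandLimited Ω : Set (Ell2 ℤ ℝ)) := by
  have : (bandLimited Ω : Set (Ell2 ℤ ℝ)) =
      (fun x => LpToLpRestrictCLM _ ℂ ℂ haarAddCircle 2 (stopBand Ω)
        ((fourierBasis (T := 2 * Real.pi)).repr.symm (complexify x))) ⁻¹' {0} :=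
    Set.ext fun x => mem_bandLimited_iff Ω x
  rw [this]
  refine isClosed_singleton.preimage ?_
  exact (ContinuousLinearMap.continuous _).comp
    ((LinearIsometryEquiv.continuous _).comp continuous_complexify)

end Closed

end DataRecovery

end

theorem mainTheorem4 (Ω : ℝ) (hΩ_pos : 0 < Ω) (hΩ_lt : Ω < Real.pi) (D : Set ℤ)
    (hD : ∃ s : ℤ, {t : ℤ | t ≤ s} ⊆ D ∨ {t : ℤ | s ≤ t} ⊆ D) :
    DataRecovery.RecoveryCondition (DataRecovery.bandLimited Ω) D := by
  refine ⟨?_, DataRecovery.isClosed_bandLimited Ω⟩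
  rintro _ ⟨y, hy, rfl⟩
  refine ⟨y, ⟨hy, fun _ => rfl⟩, fun z ⟨hz, hzy⟩ => ?_⟩
  have hD0 : ∀ t ∈ D, (z - y) t = 0 := fun t ht => by
    rw [lp.coeFn_sub, Pi.sub_apply, sub_eq_zero]
    exact hzy ⟨t, ht⟩
  obtain ⟨s, hs⟩ := hD
  rw [← sub_eq_zero]
  refine DataRecovery.eq_zero_of_mem_bandLimited hΩ_pos hΩ_lt
    ((DataRecovery.bandLimited Ω).sub_mem hz hy) (s := s) ?_
  exact hs.imp (fun h t ht => hD0 t (h ht)) (fun h t ht => hD0 t (h ht))
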